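/- Let $C>0$ and let $(x_i,y_i)$, $i=1,\dots,m$, be training data with $x_i\in\mathbb R^n$ and $y_i\in\{-1,1\}$. Let $B\in\mathbb R^{m\times n}$ be the matrix whose $i$-th row is $-y_ix_i^T$, let $d=(1,\dots,1)^T\in\mathbb R^m$, and let $p(s)=C\sum_{i=1}^m\max(s_i,0)$ for $s\in\mathbb R^m$. Consider the (reformulated L1-loss support vector classification) problem $$\text{(P)}\qquad \min_{w\in\mathbb R^n,\ s\in\mathbb R^m}\ \tfrac12\|w\|^2+p(s)\quad\text{s.t.}\quad s=Bw+d,$$ and its dual $$\text{(D)}\qquad \max_{\lambda\in\mathbb R^m}\ -\tfrac12\|B^T\lambda\|^2+\langle\lambda,d\rangle-p^*(\lambda),$$ where $\|\cdot\|$ is the Euclidean norm and $p^*(\lambda)=\sup_{s\in\mathbb R^m}\left(\langle s,\lambda\rangle-p(s)\right)\in(-\infty,+\infty]$ is the Fenchel conjugate of $p$. For $\sigma>0$ let $$L_\sigma(w,s;\lambda)=\tfrac12\|w\|^2+p(s)-\langle\lambda,s-Bw-d\rangle+\tfrac{\sigma}{2}\|s-Bw-d\|^2$$ be the augmented Lagrangian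 function of (P). Let $\{(w^k,s^k,\lambda^k)\}_{k\ge0}$ be generated by the inexact augmented Lagrangian method: the starting point $(w^0,s^0,\lambda^0)$ is arbitrary, $0<\sigma_0\le\sigma_1\le\sigma_2\le\cdots$ are real numbers, and for every $k\ge0$ the pair $(w^{k+1},s^{k+1})$ is an approximate minimizer of $\Psi_k(w,s):=L_{\sigma_k}(w,s;\lambda^k)$ satisfying the stopping criterion $$\text{(A)}\qquad \Psi_k(w^{k+1},s^{k+1})-\inf\Psi_k\le\frac{\epsilon_k^2}{2\sigma_k},\qquad \epsilon_k\ge0,\quad \sum_{k=0}^\infty\epsilon_k<+\infty,$$ and $\lambda^{k+1}=\lambda^k-\sigma_k(s^{k+1}-Bw^{k+1}-d)$. Then the sequence $\{\lambda^k\}$ is bounded and converges to an optimal solution of (D). Moreover, (P) has a unique optimal solution $(w^*,s^*)$, and the sequence $\{(w^k,s^k)\}$ is bounded and converges to $(w^*,s^*)$. -/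

import Mathlib

open Filter Topology

noncomputable section

namespace L1SVC

/-- The matrix `B`, whose `i`-th row is `-(yᵢ xᵢᵀ)`. -/
def svcMatrix {m n : ℕ} (x : Fin m → EuclideanSpace ℝ (Fin n)) (y : Fin m → ℝ) :
    Matrix (Fin m) (Fin n) ℝ :=
  Matrix.of fun i j => -(y i * x i j)

/-- The vector `d` of all ones. -/
def svcOffset (m : ℕ) : EuclideanSpace ℝ (Fin m) :=
  WithLp.toLp 2 fun _ => 1

/-- The hinge penalty `p(s) = C ∑ᵢ max(sᵢ, 0)`. -/
def hinge {m : ℕ} (C : ℝ) (s : EuclideanSpace ℝ (Fin m)) : ℝ :=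
  C * ∑ i, max (s i) 0

/-- The Fenchel conjugate `q*(y) = sup_s (⟨s, y⟩ - q(s))`, with values in `[-∞, ∞]`. -/
def fenchelConj {m : ℕ} (q : EuclideanSpace ℝ (Fin m) → ℝ) (y : EuclideanSpace ℝ (Fin m)) :
    EReal :=
  ⨆ s : EuclideanSpace ℝ (Fin m), ((inner ℝ s y - q s : ℝ) : EReal)

/-- The constraint residual `s - B w - d`. -/
def residual {m n : ℕ} (B : Matrix (Fin m) (Fin n) ℝ) (d : EuclideanSpace ℝ (Fin m))
    (w : EuclideanSpace ℝ (Fin n)) (s : EuclideanSpace ℝ (Fin m)) : EuclideanSpace ℝ (Fin m) :=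
  s - Matrix.toEuclideanLin B w - d

/-- The primal objective `½‖w‖² + p(s)`. -/
def primalObj {m n : ℕ} (C : ℝ) (q : EuclideanSpace ℝ (Fin n) × EuclideanSpace ℝ (Fin m)) : ℝ :=
  1 / 2 * ‖q.1‖ ^ 2 + hinge C q.2

/-- The primal feasible set `{(w, s) | s = B w + d}`. -/
def feasibleSet {m n : ℕ} (B : Matrix (Fin m) (Fin n) ℝ) (d : EuclideanSpace ℝ (Fin m)) :
    Set (EuclideanSpace ℝ (Fin n) × EuclideanSpace ℝ (Fin m)) :=
  {q | q.2 = Matrix.toEuclideanLin B q.1 + d}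

/-- `(w, s)` is an optimal solution of the problem
`min ½‖w‖² + p(s)` subject to `s = B w + d`. -/
def IsPrimalOptimal {m n : ℕ} (C : ℝ) (B : Matrix (Fin m) (Fin n) ℝ)
    (d : EuclideanSpace ℝ (Fin m)) (q : EuclideanSpace ℝ (Fin n) × EuclideanSpace ℝ (Fin m)) :
    Prop :=
  q ∈ feasibleSet B d ∧ IsMinOn (primalObj C) (feasibleSet B d) q

/-- The dual objective `-½‖Bᵀλ‖² + ⟨λ, d⟩ - p*(λ)`, with values in `[-∞, ∞]`. -/
def dualObj {m n : ℕ} (C : ℝ) (B : Matrix (Fin m) (Fin n) ℝ) (d : EuclideanSpace ℝ (Fin m))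
    (lam : EuclideanSpace ℝ (Fin m)) : EReal :=
  ((-(1 / 2 * ‖Matrix.toEuclideanLin B.transpose lam‖ ^ 2) + inner ℝ lam d : ℝ) : EReal)
    - fenchelConj (hinge C) lam

/-- `λ` is an optimal solution of the dual problem: it maximizes the dual objective. -/
def IsDualOptimal {m n : ℕ} (C : ℝ) (B : Matrix (Fin m) (Fin n) ℝ)
    (d : EuclideanSpace ℝ (Fin m)) (lam : EuclideanSpace ℝ (Fin m)) : Prop :=
  IsMaxOn (dualObj C B d) Set.univ lam

/-- The augmented Lagrangian
`L_σ(w, s; λ) = ½‖w‖² + p(s) - ⟨λ, s - B w - d⟩ + (σ/2) ‖s - B w - d‖²`. -/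
def augLagrangian {m n : ℕ} (C : ℝ) (B : Matrix (Fin m) (Fin n) ℝ)
    (d : EuclideanSpace ℝ (Fin m)) (σ : ℝ) (lam : EuclideanSpace ℝ (Fin m))
    (q : EuclideanSpace ℝ (Fin n) × EuclideanSpace ℝ (Fin m)) : ℝ :=
  1 / 2 * ‖q.1‖ ^ 2 + hinge C q.2 - inner ℝ lam (residual B d q.1 q.2)
    + σ / 2 * ‖residual B d q.1 q.2‖ ^ 2

/-- The augmented Lagrangian is bounded below, so its infimum below is a genuine one. -/
theorem bddBelow_augLagrangian {m n : ℕ} {C : ℝ} (hC : 0 < C) (B : Matrix (Fin m) (Fin n) ℝ)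
    (d : EuclideanSpace ℝ (Fin m)) {σ : ℝ} (hσ : 0 < σ) (lam : EuclideanSpace ℝ (Fin m)) :
    BddBelow (Set.range (augLagrangian C B d σ lam)) := by
  refine ⟨-(‖lam‖ ^ 2 / (2 * σ)), ?_⟩
  rintro _ ⟨q, rfl⟩
  have h1 : 0 ≤ hinge C q.2 :=
    mul_nonneg hC.le (Finset.sum_nonneg fun i _ => le_max_right _ _)
  have h2 := real_inner_le_norm lam (residual B d q.1 q.2)
  have h3 : 0 ≤ ‖lam‖ ^ 2 / (2 * σ) - ‖lam‖ * ‖residual B d q.1 q.2‖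
      + σ / 2 * ‖residual B d q.1 q.2‖ ^ 2 := by
    have h4 : ‖lam‖ ^ 2 / (2 * σ) - ‖lam‖ * ‖residual B d q.1 q.2‖
      + σ / 2 * ‖residual B d q.1 q.2‖ ^ 2
        = (‖lam‖ - σ * ‖residual B d q.1 q.2‖) ^ 2 / (2 * σ) := by
      field_simp
      ring
    rw [h4]
    positivity
  have h5 : 0 ≤ 1 / 2 * ‖q.1‖ ^ 2 := by positivity
  unfold augLagrangian
  linarith

/-- The (inexact) augmented Lagrangian iteration: the penalty parameters are positive and
nondecreasing, and the multipliers follow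
`λ^{k+1} = λ^k - σ_k (s^{k+1} - B w^{k+1} - d)`. How accurately `(w^{k+1}, s^{k+1})` solves the
subproblem `min L_{σ_k}(·, ·; λ^k)` is prescribed by the stopping criterion. The starting point
`(w^0, s^0, λ^0)` is arbitrary. -/
structure IsALM {m n : ℕ} (B : Matrix (Fin m) (Fin n) ℝ) (d : EuclideanSpace ℝ (Fin m))
    (σ : ℕ → ℝ) (w : ℕ → EuclideanSpace ℝ (Fin n)) (s lam : ℕ → EuclideanSpace ℝ (Fin m)) :
    Prop where
  sigma_pos : 0 < σ 0
  sigma_mono : ∀ k, σ k ≤ σ (k + 1)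
  update : ∀ k, lam (k + 1) = lam k - σ k • residual B d (w (k + 1)) (s (k + 1))

/-- Stopping criterion (A): with `Ψ_k = L_{σ_k}(·, ·; λ^k)`,
`Ψ_k(w^{k+1}, s^{k+1}) - inf Ψ_k ≤ ε_k² / (2 σ_k)`, where `ε_k ≥ 0` and `∑ ε_k < ∞`. -/
structure StoppingA {m n : ℕ} (C : ℝ) (B : Matrix (Fin m) (Fin n) ℝ)
    (d : EuclideanSpace ℝ (Fin m)) (σ ε : ℕ → ℝ) (w : ℕ → EuclideanSpace ℝ (Fin n))
    (s lam : ℕ → EuclideanSpace ℝ (Fin m)) : Prop where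
  eps_nonneg : ∀ k, 0 ≤ ε k
  eps_summable : Summable ε
  gap_le : ∀ k, augLagrangian C B d (σ k) (lam k) (w (k + 1), s (k + 1))
    - (⨅ q, augLagrangian C B d (σ k) (lam k) q) ≤ ε k ^ 2 / (2 * σ k)

end L1SVC

end

/-! The penalty p is the support function of the box [0, C]^m, so p* vanishes on the box and is
infinite off it: (D) maximizes a concave quadratic over a compact convex set. It is handled through
its variational inequality, `IsBoxSolution` with τ = 0.

The method is an inexact proximal point method on (D). The exact proximal point of λ^k solves the
box problem with τ = 1/σ_k and offset d + λ^k/σ_k. By `prox_gap`, criterion (A) puts λ^{k+1} within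
ε_k of it and also controls w^{k+1} + Bᵀ(proximal point). By `prox_fejer`, exact steps do not
increase the distance to any solution z. Since ∑ ε_k < ∞, these distances converge and the steps
vanish; a cluster point in the box is then a solution, and its distance to λ^k tends to 0.

On the primal side w^k → -Bᵀz, and the multiplier update forces the residual to 0, which fixes the
limit of s^k. Strong convexity in w, together with s = Bw + d, gives uniqueness. -/

namespace L1SVC

/-! ### The hinge penalty as support function of a box -/

section Box

variable {m : ℕ} {C : ℝ}

/-- The box `[0, C]^m`, the effective domain of the conjugate of the hinge penalty. -/
def box (m : ℕ) (C : ℝ) : Set (EuclideanSpace ℝ (Fin m)) :=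
  {l | ∀ i, 0 ≤ l i ∧ l i ≤ C}

theorem inner_eq_sum (a b : EuclideanSpace ℝ (Fin m)) : inner ℝ a b = ∑ i, a i * b i := by
  simp [PiLp.inner_apply, mul_comm]

theorem isCompact_box : IsCompact (box m C) := by
  refine Metric.isCompact_of_isClosed_isBounded ?_ ?_
  · have : box m C = ⋂ i, {l : EuclideanSpace ℝ (Fin m) | 0 ≤ l i ∧ l i ≤ C} := by
      ext l; simp [box]
    rw [this]
    refine isClosed_iInter fun i => ?_
    have hi : Continuous fun l : EuclideanSpace ℝ (Fin m) => l i := by fun_prop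
    exact (isClosed_le continuous_const hi).inter (isClosed_le hi continuous_const)
  · refine (Metric.isBounded_iff_subset_closedBall 0).2 ⟨√(∑ _i : Fin m, C ^ 2), fun l hl => ?_⟩
    rw [mem_closedBall_zero_iff, EuclideanSpace.norm_eq]
    refine Real.sqrt_le_sqrt (Finset.sum_le_sum fun i _ => ?_)
    rw [Real.norm_eq_abs, sq_abs]
    exact pow_le_pow_left₀ (hl i).1 (hl i).2 2

theorem convex_box : Convex ℝ (box m C) := by
  intro a ha b hb s t hs ht hst i
  have h1 := ha i
  have h2 := hb i
  simp only [PiLp.add_apply, PiLp.smul_apply, smul_eq_mul]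
  constructor
  · exact add_nonneg (mul_nonneg hs h1.1) (mul_nonneg ht h2.1)
  · calc s * a i + t * b i ≤ s * C + t * C :=
          add_le_add (mul_le_mul_of_nonneg_left h1.2 hs) (mul_le_mul_of_nonneg_left h2.2 ht)
      _ = C := by rw [← add_mul, hst, one_mul]

theorem box_nonempty (hC : 0 ≤ C) : (box m C).Nonempty := ⟨0, fun _ => ⟨le_rfl, hC⟩⟩

theorem inner_le_hinge {l : EuclideanSpace ℝ (Fin m)} (hl : l ∈ box m C)
    (s : EuclideanSpace ℝ (Fin m)) : inner ℝ l s ≤ hinge C s := by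
  rw [inner_eq_sum, hinge, Finset.mul_sum]
  refine Finset.sum_le_sum fun i _ => ?_
  calc l i * s i ≤ l i * max (s i) 0 := mul_le_mul_of_nonneg_left (le_max_left _ _) (hl i).1
    _ ≤ C * max (s i) 0 := mul_le_mul_of_nonneg_right (hl i).2 (le_max_right _ _)

theorem exists_mem_box_inner_eq_hinge (hC : 0 ≤ C) (s : EuclideanSpace ℝ (Fin m)) :
    ∃ u ∈ box m C, inner ℝ s u = hinge C s := by
  refine ⟨WithLp.toLp 2 fun i => if 0 < s i then C else 0, fun i => ?_, ?_⟩
  · dsimp only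
    split_ifs <;> simp [hC]
  · rw [inner_eq_sum, hinge, Finset.mul_sum]
    refine Finset.sum_congr rfl fun i _ => ?_
    dsimp only
    split_ifs with h
    · rw [max_eq_left h.le, mul_comm]
    · rw [max_eq_right (not_lt.1 h)]; simp

/-- A point `s` of the normal cone of the box at `l` attains `p(s) = ⟨l, s⟩`. -/
theorem hinge_eq_inner_of_normal (hC : 0 ≤ C) {l s : EuclideanSpace ℝ (Fin m)}
    (hl : l ∈ box m C) (h : ∀ u ∈ box m C, inner ℝ s (u - l) ≤ 0) :
    hinge C s = inner ℝ l s := by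
  refine le_antisymm ?_ (inner_le_hinge hl s)
  obtain ⟨u, hu, hus⟩ := exists_mem_box_inner_eq_hinge hC s
  have := h u hu
  rw [inner_sub_right, hus, real_inner_comm] at this
  linarith

theorem fenchelConj_hinge_of_mem {l : EuclideanSpace ℝ (Fin m)} (hl : l ∈ box m C) :
    fenchelConj (hinge C) l = 0 := by
  refine le_antisymm (iSup_le fun s => ?_) ?_
  · have := inner_le_hinge hl s
    rw [real_inner_comm] at this
    exact_mod_cast sub_nonpos.2 this
  · refine le_iSup_of_le 0 ?_
    simp [hinge]

theorem fenchelConj_hinge_of_notMem {l : EuclideanSpace ℝ (Fin m)}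
    (hl : l ∉ box m C) : fenchelConj (hinge C) l = ⊤ := by
  obtain ⟨i, hi⟩ : ∃ i, ¬ (0 ≤ l i ∧ l i ≤ C) := by
    simpa only [box, Set.mem_ofPred_eq, not_forall] using hl
  have key : ∀ t : ℝ, inner ℝ (EuclideanSpace.single i t) l - hinge C (EuclideanSpace.single i t)
      = t * l i - C * max t 0 := by
    intro t
    have h1 : inner ℝ (EuclideanSpace.single i t) l = t * l i := by
      rw [EuclideanSpace.inner_single_left]; simp
    have h2 : ∑ j, max ((EuclideanSpace.single i t : EuclideanSpace ℝ (Fin m)) j) 0 = max t 0 := by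
      rw [Finset.sum_eq_single i]
      · simp
      · intro j _ hj; simp [hj]
      · simp
    rw [h1, hinge, h2]
  rw [EReal.eq_top_iff_forall_lt]
  intro M
  obtain ⟨t, ht⟩ : ∃ t : ℝ, M < t * l i - C * max t 0 := by
    rcases not_and_or.1 hi with h | h
    · have h' : l i < 0 := not_le.1 h
      -- A negative t costs no penalty, and this one makes t * l i equal to |M| + 1.
      refine ⟨(|M| + 1) / l i, ?_⟩
      have : (|M| + 1) / l i ≤ 0 := div_nonpos_of_nonneg_of_nonpos (by positivity) h'.le
      rw [max_eq_right this, div_mul_cancel₀ _ h'.ne]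
      linarith [le_abs_self M]
    · have h' : 0 < l i - C := sub_pos.2 (not_le.1 h)
      refine ⟨(|M| + 1) / (l i - C), ?_⟩
      have h3 : 0 ≤ (|M| + 1) / (l i - C) := by positivity
      rw [max_eq_left h3]
      have h4 : (|M| + 1) / (l i - C) * (l i - C) = |M| + 1 := div_mul_cancel₀ _ h'.ne'
      nlinarith [le_abs_self M]
  refine lt_of_lt_of_le (EReal.coe_lt_coe_iff.2 ht) ?_
  rw [← key]
  exact le_iSup (fun s : EuclideanSpace ℝ (Fin m) => ((inner ℝ s l - hinge C s : ℝ) : EReal)) _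

end Box

/-! ### Optimality conditions and the proximal step -/

section Duality

variable {m n : ℕ} {C : ℝ} (B : Matrix (Fin m) (Fin n) ℝ) (d : EuclideanSpace ℝ (Fin m))

theorem inner_toEuclideanLin_transpose (l : EuclideanSpace ℝ (Fin m))
    (w : EuclideanSpace ℝ (Fin n)) :
    inner ℝ (Matrix.toEuclideanLin B.transpose l) w = inner ℝ l (Matrix.toEuclideanLin B w) := by
  rw [← Matrix.conjTranspose_eq_transpose_of_trivial,
    Matrix.toEuclideanLin_conjTranspose_eq_adjoint, LinearMap.adjoint_inner_left]

/-- `λ` solves the variational inequality of maximizing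
`⟨b, λ⟩ - ½‖Bᵀλ‖² - (τ/2)‖λ‖²` over the box. -/
def IsBoxSolution (C : ℝ) (τ : ℝ) (l : EuclideanSpace ℝ (Fin m)) : Prop :=
  l ∈ box m C ∧ ∀ u ∈ box m C, inner ℝ
    (d - Matrix.toEuclideanLin B (Matrix.toEuclideanLin B.transpose l) - τ • l) (u - l) ≤ 0

/-- A maximizer exists by compactness. Comparing it with l + t(u - l), dividing by t and letting t ↓
0 yields the first-order condition. -/
theorem exists_isBoxSolution (hC : 0 ≤ C) (τ : ℝ) : ∃ l, IsBoxSolution B d C τ l := by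
  let T := Matrix.toEuclideanLin B.transpose
  have hT : Continuous T := T.continuous_of_finiteDimensional
  obtain ⟨l, hl, hmax⟩ := (isCompact_box (m := m) (C := C)).exists_isMaxOn (box_nonempty hC)
    (f := fun l => inner ℝ d l - 1 / 2 * ‖T l‖ ^ 2 - τ / 2 * ‖l‖ ^ 2)
    (by fun_prop)
  refine ⟨l, hl, fun u hu => ?_⟩
  have hsym : inner ℝ (Matrix.toEuclideanLin B (T l)) (u - l) = inner ℝ (T l) (T (u - l)) := by
    rw [real_inner_comm, ← inner_toEuclideanLin_transpose, real_inner_comm]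
  rw [inner_sub_left, inner_sub_left, inner_smul_left, hsym]
  simp only [conj_trivial]
  set g := inner ℝ d (u - l) - inner ℝ (T l) (T (u - l)) - τ * inner ℝ l (u - l) with hg
  set q := 1 / 2 * ‖T (u - l)‖ ^ 2 + τ / 2 * ‖u - l‖ ^ 2 with hq
  have key : ∀ t : ℝ, 0 < t → t ≤ 1 → g ≤ t * q := by
    intro t ht0 ht1
    have hmem : l + t • (u - l) ∈ box m C := convex_box.add_smul_sub_mem hl hu ⟨ht0.le, ht1⟩
    have := hmax hmem
    simp only [Set.mem_ofPred_eq, map_add, map_smul, inner_add_right, inner_smul_right,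
      norm_add_sq_real, norm_smul, mul_pow, Real.norm_eq_abs, sq_abs] at this
    have h2 : t * g ≤ t * (t * q) := by rw [hg, hq]; linarith
    exact le_of_mul_le_mul_left h2 ht0
  have hlim : Tendsto (fun t : ℝ => t * q) (𝓝[>] 0) (𝓝 0) := by
    have : Tendsto (fun t : ℝ => t * q) (𝓝 0) (𝓝 (0 * q)) := tendsto_id.mul_const q
    rw [zero_mul] at this
    exact this.mono_left nhdsWithin_le_nhds
  refine ge_of_tendsto hlim ?_
  filter_upwards [Ioc_mem_nhdsGT (zero_lt_one' ℝ)] with t ht using key t ht.1 ht.2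

/-- The quadratic expansion around l is exact: the first-order term is nonpositive on the box and
the remainder is -½‖Bᵀ(u - l)‖². Off the box the objective is -∞. -/
theorem IsBoxSolution.isDualOptimal {l : EuclideanSpace ℝ (Fin m)}
    (h : IsBoxSolution B d C 0 l) : IsDualOptimal C B d l := by
  intro u _
  show dualObj C B d u ≤ dualObj C B d l
  by_cases hu : u ∈ box m C
  · unfold dualObj
    rw [fenchelConj_hinge_of_mem hu, fenchelConj_hinge_of_mem h.1, sub_zero, sub_zero,
      EReal.coe_le_coe_iff]
    have h1 := h.2 u hu
    set T := Matrix.toEuclideanLin B.transpose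
    have hsym : inner ℝ (Matrix.toEuclideanLin B (T l)) (u - l) = inner ℝ (T l) (T (u - l)) := by
      rw [real_inner_comm, ← inner_toEuclideanLin_transpose, real_inner_comm]
    have h2 : ‖T u‖ ^ 2 = ‖T l‖ ^ 2 + 2 * inner ℝ (T l) (T (u - l)) + ‖T (u - l)‖ ^ 2 := by
      rw [← norm_add_sq_real, ← map_add, add_sub_cancel]
    rw [zero_smul, sub_zero, inner_sub_left, hsym, inner_sub_right d, real_inner_comm u d,
      real_inner_comm l d] at h1
    have h3 := sq_nonneg ‖T (u - l)‖
    linarith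
  · unfold dualObj
    rw [fenchelConj_hinge_of_notMem hu, EReal.sub_top]
    exact bot_le

/-- The Lagrangian at `l` in the box exceeds its minimum over `w` and the term `p(s) - ⟨l, s⟩`
by `½‖w + Bᵀ l‖²`. -/
theorem lagrangian_eq (l : EuclideanSpace ℝ (Fin m)) (w : EuclideanSpace ℝ (Fin n))
    (s : EuclideanSpace ℝ (Fin m)) :
    1 / 2 * ‖w‖ ^ 2 + hinge C s - inner ℝ l (residual B d w s)
      = 1 / 2 * ‖w + Matrix.toEuclideanLin B.transpose l‖ ^ 2
        + (hinge C s - inner ℝ l s)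
        - 1 / 2 * ‖Matrix.toEuclideanLin B.transpose l‖ ^ 2 + inner ℝ l d := by
  rw [norm_add_sq_real, real_inner_comm _ w, inner_toEuclideanLin_transpose, residual, inner_sub_right,
    inner_sub_right]
  ring

/-- The primal point `(-Bᵀλ, d - B Bᵀ λ)` attached to a multiplier. -/
noncomputable def primalOf (l : EuclideanSpace ℝ (Fin m)) :
    EuclideanSpace ℝ (Fin n) × EuclideanSpace ℝ (Fin m) :=
  (-Matrix.toEuclideanLin B.transpose l,
    d - Matrix.toEuclideanLin B (Matrix.toEuclideanLin B.transpose l))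

theorem residual_primalOf_add (l v : EuclideanSpace ℝ (Fin m)) :
    residual B d (primalOf B d l).1 ((primalOf B d l).2 + v) = v := by
  simp only [residual, primalOf, map_neg]
  abel

theorem residual_eq_zero_of_mem {q : EuclideanSpace ℝ (Fin n) × EuclideanSpace ℝ (Fin m)}
    (hq : q ∈ feasibleSet B d) : residual B d q.1 q.2 = 0 := by
  have : q.2 = Matrix.toEuclideanLin B q.1 + d := hq
  rw [residual, this]; abel

theorem primalOf_mem_feasibleSet (l : EuclideanSpace ℝ (Fin m)) :
    primalOf B d l ∈ feasibleSet B d := by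
  simp only [feasibleSet, primalOf, Set.mem_ofPred_eq, map_neg]
  abel

variable {B d}

/-- On feasible points the Lagrangian at l is the objective. Both the square and p(s) - ⟨l, s⟩
vanish at `primalOf`, while the latter is nonnegative elsewhere, so the square survives as a
quadratic growth bound. -/
theorem IsBoxSolution.primalObj_ge (hC : 0 ≤ C) {l : EuclideanSpace ℝ (Fin m)}
    (h : IsBoxSolution B d C 0 l) {q : EuclideanSpace ℝ (Fin n) × EuclideanSpace ℝ (Fin m)}
    (hq : q ∈ feasibleSet B d) :
    primalObj C (primalOf B d l) + 1 / 2 * ‖q.1 - (primalOf B d l).1‖ ^ 2 ≤ primalObj C q := by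
  have h1 := lagrangian_eq (C := C) B d l q.1 q.2
  have h2 := lagrangian_eq (C := C) B d l (primalOf B d l).1 (primalOf B d l).2
  have h3 : hinge C (primalOf B d l).2 = inner ℝ l (primalOf B d l).2 :=
    hinge_eq_inner_of_normal hC h.1 fun u hu => by
      simpa only [zero_smul, sub_zero, primalOf] using h.2 u hu
  have h4 := inner_le_hinge h.1 q.2
  rw [residual_eq_zero_of_mem B d hq, inner_zero_right] at h1
  rw [residual_eq_zero_of_mem B d (primalOf_mem_feasibleSet B d l), inner_zero_right, h3] at h2
  have h5 : (primalOf B d l).1 + Matrix.toEuclideanLin B.transpose l = 0 := neg_add_cancel _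
  have h6 : q.1 - (primalOf B d l).1 = q.1 + Matrix.toEuclideanLin B.transpose l :=
    sub_neg_eq_add _ _
  rw [h5, norm_zero] at h2
  rw [h6]
  unfold primalObj
  rw [h3]
  linarith

theorem IsBoxSolution.isPrimalOptimal (hC : 0 ≤ C) {l : EuclideanSpace ℝ (Fin m)}
    (h : IsBoxSolution B d C 0 l) : IsPrimalOptimal C B d (primalOf B d l) := by
  refine ⟨primalOf_mem_feasibleSet B d l, fun q hq => ?_⟩
  have := h.primalObj_ge hC hq
  have h2 := sq_nonneg ‖q.1 - (primalOf B d l).1‖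
  show primalObj C (primalOf B d l) ≤ primalObj C q
  linarith

theorem IsBoxSolution.eq_primalOf (hC : 0 ≤ C) {l : EuclideanSpace ℝ (Fin m)}
    (h : IsBoxSolution B d C 0 l) {q : EuclideanSpace ℝ (Fin n) × EuclideanSpace ℝ (Fin m)}
    (hq : IsPrimalOptimal C B d q) : q = primalOf B d l := by
  have h1 := h.primalObj_ge hC hq.1
  have h2 : primalObj C q ≤ primalObj C (primalOf B d l) := hq.2 (primalOf_mem_feasibleSet B d l)
  have h3 : ‖q.1 - (primalOf B d l).1‖ ^ 2 = 0 :=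
    le_antisymm (by linarith) (sq_nonneg _)
  have h4 : q.1 = (primalOf B d l).1 := by
    rw [← sub_eq_zero, ← norm_eq_zero]
    exact pow_eq_zero_iff two_ne_zero |>.1 h3
  have h5 : q.2 = Matrix.toEuclideanLin B q.1 + d := hq.1
  have h6 : (primalOf B d l).2 = Matrix.toEuclideanLin B (primalOf B d l).1 + d :=
    primalOf_mem_feasibleSet B d l
  exact Prod.ext h4 (by rw [h5, h6, h4])

/-- The augmented Lagrangian is the quadratically penalized Lagrangian, up to the distance to the
updated multiplier. -/
theorem augLagrangian_eq {σ : ℝ} (hσ : 0 < σ) (l u : EuclideanSpace ℝ (Fin m))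
    (w : EuclideanSpace ℝ (Fin n)) (s : EuclideanSpace ℝ (Fin m)) :
    augLagrangian C B d σ l (w, s)
      = 1 / 2 * ‖w‖ ^ 2 + hinge C s - inner ℝ u (residual B d w s) - ‖u - l‖ ^ 2 / (2 * σ)
        + ‖u - (l - σ • residual B d w s)‖ ^ 2 / (2 * σ) := by
  set r := residual B d w s with hr
  have h1 : u - (l - σ • r) = (u - l) + σ • r := by abel
  rw [h1, norm_add_sq_real, inner_smul_right, inner_sub_left, norm_smul, mul_pow, Real.norm_eq_abs,
    sq_abs]
  simp only [augLagrangian, ← hr]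
  field_simp
  ring

/-- The exact proximal step `l'` from `l` controls the multiplier update and the primal iterate
by the optimality gap of the augmented Lagrangian. -/
theorem IsBoxSolution.prox_gap (hC : 0 < C) {σ : ℝ} (hσ : 0 < σ) {l l' : EuclideanSpace ℝ (Fin m)}
    (h : IsBoxSolution B (d + σ⁻¹ • l) C σ⁻¹ l') (w : EuclideanSpace ℝ (Fin n))
    (s : EuclideanSpace ℝ (Fin m)) :
    1 / 2 * ‖w + Matrix.toEuclideanLin B.transpose l'‖ ^ 2
        + ‖l' - (l - σ • residual B d w s)‖ ^ 2 / (2 * σ)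
      ≤ augLagrangian C B d σ l (w, s) - ⨅ q, augLagrangian C B d σ l q := by
  -- Shifting s by v makes the residual v, so the multiplier update from this test point is exactly
  -- l'; its value bounds the infimum from above.
  set v := σ⁻¹ • (l - l') with hv
  have h0 := ciInf_le (bddBelow_augLagrangian hC B d hσ l)
    ((primalOf B d l').1, (primalOf B d l').2 + v)
  have h1 := augLagrangian_eq (C := C) (B := B) (d := d) hσ l l' w s
  have h2 := augLagrangian_eq (C := C) (B := B) (d := d) hσ l l'
    (primalOf B d l').1 ((primalOf B d l').2 + v)
  rw [lagrangian_eq] at h1 h2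
  have h3 : l' - (l - σ • residual B d (primalOf B d l').1 ((primalOf B d l').2 + v)) = 0 := by
    rw [residual_primalOf_add, hv, smul_smul, mul_inv_cancel₀ hσ.ne', one_smul]
    abel
  have h4 : hinge C ((primalOf B d l').2 + v) = inner ℝ l' ((primalOf B d l').2 + v) := by
    refine hinge_eq_inner_of_normal hC.le h.1 fun u hu => ?_
    have h5 := h.2 u hu
    have h6 : (primalOf B d l').2 + v = d + σ⁻¹ • l
        - Matrix.toEuclideanLin B (Matrix.toEuclideanLin B.transpose l') - σ⁻¹ • l' := by
      rw [hv, smul_sub, primalOf]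
      module
    rwa [h6]
  have h5 : (primalOf B d l').1 + Matrix.toEuclideanLin B.transpose l' = 0 := neg_add_cancel _
  rw [h3, h4, h5, norm_zero, norm_zero] at h2
  have h6 := inner_le_hinge h.1 s
  norm_num at h2
  linarith

/-- The proximal step moves towards every solution. -/
theorem IsBoxSolution.prox_fejer {σ : ℝ} (hσ : 0 < σ) {l l' z : EuclideanSpace ℝ (Fin m)}
    (h : IsBoxSolution B (d + σ⁻¹ • l) C σ⁻¹ l') (hz : IsBoxSolution B d C 0 z) :
    ‖l' - z‖ ^ 2 + ‖l' - l‖ ^ 2 ≤ ‖l - z‖ ^ 2 := by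
  have h1 := h.2 z hz.1
  have h2 := hz.2 l' h.1
  set A := Matrix.toEuclideanLin B
  set T := Matrix.toEuclideanLin B.transpose
  have h3 : inner ℝ (A (T (z - l'))) (z - l') = ‖T (z - l')‖ ^ 2 := by
    rw [real_inner_comm, ← inner_toEuclideanLin_transpose, real_inner_self_eq_norm_sq]
  -- Adding the two variational inequalities cancels d and leaves a monotone term, so the angle at
  -- l' between l and z is not acute.
  have h4 : inner ℝ (d + σ⁻¹ • l - A (T l') - σ⁻¹ • l') (z - l')
      + inner ℝ (d - A (T z) - (0 : ℝ) • z) (l' - z)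
      = inner ℝ (A (T (z - l'))) (z - l') + σ⁻¹ * inner ℝ (l - l') (z - l') := by
    rw [← neg_sub z l', inner_neg_right, ← sub_eq_add_neg, ← inner_sub_left,
      ← real_inner_smul_left, ← inner_add_left]
    congr 1
    simp only [map_sub, smul_sub, zero_smul]
    abel
  have h5 : σ⁻¹ * inner ℝ (l - l') (z - l') ≤ 0 := by
    have := sq_nonneg ‖T (z - l')‖
    linarith
  have h6 : inner ℝ (l - l') (z - l') ≤ 0 := by
    by_contra hc
    exact absurd h5 (not_le.2 (mul_pos (inv_pos.2 hσ) (not_le.1 hc)))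
  have h7 : l - z = (l - l') - (z - l') := by abel
  rw [h7, norm_sub_sq_real (l - l'), norm_sub_rev l' z, norm_sub_rev l' l]
  linarith

end Duality

/-! ### Quasi-Fejér convergence and the primal limit -/

section Convergence

/-- A nonnegative sequence that increases by summable amounts converges. -/
theorem exists_tendsto_of_le_add_summable {a ε : ℕ → ℝ} (ha : ∀ k, 0 ≤ a k)
    (hε0 : ∀ k, 0 ≤ ε k) (hε : Summable ε) (h : ∀ k, a (k + 1) ≤ a k + ε k) :
    ∃ r, Tendsto a atTop (𝓝 r) := by
  have hanti : Antitone fun k => a k - ∑ j ∈ Finset.range k, ε j := by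
    refine antitone_nat_of_succ_le fun k => ?_
    rw [Finset.sum_range_succ]
    linarith [h k]
  have hbdd : BddBelow (Set.range fun k => a k - ∑ j ∈ Finset.range k, ε j) := by
    refine ⟨-∑' j, ε j, ?_⟩
    rintro _ ⟨k, rfl⟩
    have := hε.sum_le_tsum (Finset.range k) fun j _ => hε0 j
    dsimp only
    linarith [ha k]
  have := (tendsto_atTop_ciInf hanti hbdd).add hε.hasSum.tendsto_sum_nat
  simp only [sub_add_cancel] at this
  exact ⟨_, this⟩

variable {m n : ℕ} {C : ℝ} {B : Matrix (Fin m) (Fin n) ℝ} {d : EuclideanSpace ℝ (Fin m)}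
  {σ ε : ℕ → ℝ} {lam bar : ℕ → EuclideanSpace ℝ (Fin m)}

theorem tendsto_dist_of_fejer {z : EuclideanSpace ℝ (Fin m)} (hε0 : ∀ k, 0 ≤ ε k)
    (hε : Summable ε) (herr : ∀ k, ‖bar k - lam (k + 1)‖ ≤ ε k)
    (hf : ∀ k, ‖bar k - z‖ ^ 2 + ‖bar k - lam k‖ ^ 2 ≤ ‖lam k - z‖ ^ 2) :
    ∃ r, Tendsto (fun k => ‖lam k - z‖) atTop (𝓝 r) := by
  refine exists_tendsto_of_le_add_summable (fun _ => norm_nonneg _) hε0 hε fun k => ?_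
  have h1 : ‖bar k - z‖ ≤ ‖lam k - z‖ :=
    le_of_sq_le_sq (by linarith [hf k, sq_nonneg ‖bar k - lam k‖]) (norm_nonneg _)
  have h2 : ‖lam (k + 1) - z‖ ≤ ‖lam (k + 1) - bar k‖ + ‖bar k - z‖ :=
    norm_sub_le_norm_sub_add_norm_sub ..
  rw [norm_sub_rev (lam (k + 1)) (bar k)] at h2
  linarith [herr k]

/-- The distances from z to `bar k` and to `lam k` share a limit, and the difference of their
squares dominates the squared step. -/
theorem tendsto_step_of_fejer {z : EuclideanSpace ℝ (Fin m)} (hε0 : ∀ k, 0 ≤ ε k)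
    (hε : Summable ε) (herr : ∀ k, ‖bar k - lam (k + 1)‖ ≤ ε k)
    (hf : ∀ k, ‖bar k - z‖ ^ 2 + ‖bar k - lam k‖ ^ 2 ≤ ‖lam k - z‖ ^ 2) :
    Tendsto (fun k => bar k - lam k) atTop (𝓝 0) := by
  obtain ⟨r, hr⟩ := tendsto_dist_of_fejer hε0 hε herr hf
  have h1 : Tendsto (fun k => ‖bar k - z‖) atTop (𝓝 r) := by
    have h2 : Tendsto (fun k => ‖bar k - z‖ - ‖lam (k + 1) - z‖) atTop (𝓝 0) := by
      refine squeeze_zero_norm (fun k => ?_) hε.tendsto_atTop_zero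
      refine (abs_norm_sub_norm_le _ _).trans ?_
      rw [sub_sub_sub_cancel_right]
      exact herr k
    have h3 := h2.add (hr.comp (tendsto_add_atTop_nat 1))
    simpa using h3
  have h4 : Tendsto (fun k => ‖bar k - lam k‖ ^ 2) atTop (𝓝 0) := by
    have h5 : Tendsto (fun k => ‖lam k - z‖ ^ 2 - ‖bar k - z‖ ^ 2) atTop (𝓝 0) := by
      simpa using (hr.pow 2).sub (h1.pow 2)
    exact squeeze_zero (fun _ => sq_nonneg _) (fun k => by linarith [hf k]) h5
  rw [tendsto_zero_iff_norm_tendsto_zero]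
  simpa using h4.sqrt

/-- Convergence of the inexact proximal point method on the dual. -/
theorem exists_tendsto_isBoxSolution (hC : 0 ≤ C) {σ₀ : ℝ} (hσ₀ : 0 < σ₀) (hσ : ∀ k, σ₀ ≤ σ k)
    (hε0 : ∀ k, 0 ≤ ε k) (hε : Summable ε) (herr : ∀ k, ‖bar k - lam (k + 1)‖ ≤ ε k)
    (hbar : ∀ k, IsBoxSolution B (d + (σ k)⁻¹ • lam k) C (σ k)⁻¹ (bar k)) :
    ∃ z, IsBoxSolution B d C 0 z ∧ Tendsto lam atTop (𝓝 z) ∧ Tendsto bar atTop (𝓝 z) := by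
  have hσpos : ∀ k, 0 < σ k := fun k => hσ₀.trans_le (hσ k)
  obtain ⟨z₀, hz₀⟩ := exists_isBoxSolution B d hC 0
  have hstep := tendsto_step_of_fejer hε0 hε herr fun k => (hbar k).prox_fejer (hσpos k) hz₀
  obtain ⟨z, hz, φ, hφ, hlim⟩ := isCompact_box.tendsto_subseq fun k => (hbar k).1
  have hscaled : Tendsto (fun k => (σ k)⁻¹ • (lam k - bar k)) atTop (𝓝 0) := by
    have h1 : Tendsto (fun k => σ₀⁻¹ * ‖bar k - lam k‖) atTop (𝓝 0) := by
      simpa using hstep.norm.const_mul σ₀⁻¹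
    refine squeeze_zero_norm (fun k => ?_) h1
    rw [norm_smul, norm_sub_rev, Real.norm_of_nonneg (inv_pos.2 (hσpos k)).le]
    exact mul_le_mul_of_nonneg_right (inv_anti₀ hσ₀ (hσ k)) (norm_nonneg _)
  have hA : Continuous (Matrix.toEuclideanLin B) := LinearMap.continuous_of_finiteDimensional _
  have hT : Continuous (Matrix.toEuclideanLin B.transpose) :=
    LinearMap.continuous_of_finiteDimensional _
  have hsol : IsBoxSolution B d C 0 z := by
    refine ⟨hz, fun u hu => ?_⟩
    have h1 : Tendsto (fun k => inner ℝ (d - Matrix.toEuclideanLin B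
        (Matrix.toEuclideanLin B.transpose (bar (φ k)))
          + (σ (φ k))⁻¹ • (lam (φ k) - bar (φ k))) (u - bar (φ k))) atTop
        (𝓝 (inner ℝ (d - Matrix.toEuclideanLin B (Matrix.toEuclideanLin B.transpose z) + 0)
          (u - z))) :=
      ((tendsto_const_nhds.sub (((hA.comp hT).tendsto z).comp hlim)).add
        (hscaled.comp hφ.tendsto_atTop)).inner (tendsto_const_nhds.sub hlim)
    rw [zero_smul, sub_zero, ← add_zero (d - _)]
    refine le_of_tendsto' h1 fun k => ?_
    have h2 := (hbar (φ k)).2 u hu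
    refine le_of_eq_of_le (congrArg (inner ℝ · _) ?_) h2
    module
  have hlam : Tendsto lam atTop (𝓝 z) := by
    -- Now that the cluster point is a solution, it can serve as the reference point: the distance
    -- to it converges, and is 0 in the limit along a subsequence.
    obtain ⟨r, hr⟩ := tendsto_dist_of_fejer hε0 hε herr
      fun k => (hbar k).prox_fejer (hσpos k) hsol
    have h1 : Tendsto (fun k => lam (φ k) - z) atTop (𝓝 0) := by
      have := (hlim.sub (hstep.comp hφ.tendsto_atTop)).sub_const z
      simpa using this
    have h2 : r = 0 :=
      tendsto_nhds_unique (hr.comp hφ.tendsto_atTop) (by simpa using! h1.norm)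
    rw [h2] at hr
    rw [← tendsto_sub_nhds_zero_iff, tendsto_zero_iff_norm_tendsto_zero]
    exact hr
  refine ⟨z, hsol, hlam, ?_⟩
  simpa using hstep.add hlam

theorem exists_tendsto_alm (hC : 0 < C) {w : ℕ → EuclideanSpace ℝ (Fin n)}
    {s : ℕ → EuclideanSpace ℝ (Fin m)} (hALM : IsALM B d σ w s lam)
    (hA : StoppingA C B d σ ε w s lam) :
    ∃ z, IsBoxSolution B d C 0 z ∧ Tendsto lam atTop (𝓝 z) ∧
      Tendsto (fun k => (w k, s k)) atTop (𝓝 (primalOf B d z)) := by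
  have hσ : ∀ k, σ 0 ≤ σ k := fun k => monotone_nat_of_le_succ hALM.sigma_mono (Nat.zero_le k)
  have hσpos : ∀ k, 0 < σ k := fun k => hALM.sigma_pos.trans_le (hσ k)
  choose bar hbar using fun k => exists_isBoxSolution B (d + (σ k)⁻¹ • lam k) hC.le (σ k)⁻¹
  set T := Matrix.toEuclideanLin B.transpose with hTdef
  have hgap : ∀ k, 1 / 2 * ‖w (k + 1) + T (bar k)‖ ^ 2 + ‖bar k - lam (k + 1)‖ ^ 2 / (2 * σ k)
      ≤ ε k ^ 2 / (2 * σ k) := by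
    intro k
    rw [hALM.update k]
    exact ((hbar k).prox_gap hC (hσpos k) _ _).trans (hA.gap_le k)
  have herr : ∀ k, ‖bar k - lam (k + 1)‖ ≤ ε k := by
    intro k
    have h1 : 0 < 2 * σ k := mul_pos two_pos (hσpos k)
    have h2 : ‖bar k - lam (k + 1)‖ ^ 2 / (2 * σ k) ≤ ε k ^ 2 / (2 * σ k) := by
      linarith [hgap k, sq_nonneg ‖w (k + 1) + T (bar k)‖]
    exact le_of_sq_le_sq ((div_le_div_iff_of_pos_right h1).1 h2) (hA.eps_nonneg k)
  obtain ⟨z, hz, hlam, hbarlim⟩ := exists_tendsto_isBoxSolution hC.le hALM.sigma_pos hσ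
    hA.eps_nonneg hA.eps_summable herr hbar
  refine ⟨z, hz, hlam, ?_⟩
  have hinv : ∀ k, (σ k)⁻¹ ≤ (σ 0)⁻¹ := fun k => inv_anti₀ hALM.sigma_pos (hσ k)
  have hcA : Continuous (Matrix.toEuclideanLin B) := LinearMap.continuous_of_finiteDimensional _
  have hcT : Continuous T := LinearMap.continuous_of_finiteDimensional _
  have hwT : Tendsto (fun k => w (k + 1) + T (bar k)) atTop (𝓝 0) := by
    have h1 : Tendsto (fun k => (σ 0)⁻¹ * ε k ^ 2) atTop (𝓝 0) := by
      simpa using (hA.eps_summable.tendsto_atTop_zero.pow 2).const_mul (σ 0)⁻¹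
    have h2 : Tendsto (fun k => ‖w (k + 1) + T (bar k)‖ ^ 2) atTop (𝓝 0) := by
      refine squeeze_zero (fun _ => sq_nonneg _) (fun k => ?_) h1
      have h3 : 0 ≤ ‖bar k - lam (k + 1)‖ ^ 2 / (2 * σ k) :=
        div_nonneg (sq_nonneg _) (mul_pos two_pos (hσpos k)).le
      have h4 : ε k ^ 2 / (2 * σ k) = 1 / 2 * ((σ k)⁻¹ * ε k ^ 2) := by
        have := (hσpos k).ne'
        field_simp
      have h5 := mul_le_mul_of_nonneg_right (hinv k) (sq_nonneg (ε k))
      linarith [hgap k]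
    rw [tendsto_zero_iff_norm_tendsto_zero]
    simpa using h2.sqrt
  have hw : Tendsto (fun k => w (k + 1)) atTop (𝓝 (-T z)) := by
    simpa using hwT.sub ((hcT.tendsto z).comp hbarlim)
  -- By the update this is the residual; it vanishes because σ k stays above σ 0 > 0.
  have hr : Tendsto (fun k => (σ k)⁻¹ • (lam k - lam (k + 1))) atTop (𝓝 0) := by
    have h1 : Tendsto (fun k => lam k - lam (k + 1)) atTop (𝓝 0) := by
      simpa using hlam.sub (hlam.comp (tendsto_add_atTop_nat 1))
    have h2 : Tendsto (fun k => (σ 0)⁻¹ * ‖lam k - lam (k + 1)‖) atTop (𝓝 0) := by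
      simpa using h1.norm.const_mul (σ 0)⁻¹
    refine squeeze_zero_norm (fun k => ?_) h2
    rw [norm_smul, Real.norm_of_nonneg (inv_pos.2 (hσpos k)).le]
    exact mul_le_mul_of_nonneg_right (hinv k) (norm_nonneg _)
  have hs : Tendsto (fun k => s (k + 1)) atTop (𝓝 (d - Matrix.toEuclideanLin B (T z))) := by
    have h1 : ∀ k, s (k + 1) = (σ k)⁻¹ • (lam k - lam (k + 1))
        + (Matrix.toEuclideanLin B (w (k + 1)) + d) := by
      intro k
      rw [hALM.update k, sub_sub_cancel, smul_smul, inv_mul_cancel₀ (hσpos k).ne', one_smul,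
        residual]
      abel
    have h2 := hr.add (((hcA.tendsto _).comp hw).add_const d)
    rw [map_neg, zero_add, neg_add_eq_sub] at h2
    exact h2.congr fun k => (h1 k).symm
  -- The arbitrary starting pair is dropped by the index shift.
  exact (tendsto_add_atTop_iff_nat 1).1 (hw.prodMk_nhds hs)

end Convergence

end L1SVC

theorem theorem1 {m n : ℕ} (C : ℝ) (hC : 0 < C)
    (x : Fin m → EuclideanSpace ℝ (Fin n)) (y : Fin m → ℝ) (hy : ∀ i, y i = -1 ∨ y i = 1)
    (σ ε : ℕ → ℝ) (w : ℕ → EuclideanSpace ℝ (Fin n)) (s lam : ℕ → EuclideanSpace ℝ (Fin m))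
    (hALM : L1SVC.IsALM (L1SVC.svcMatrix x y) (L1SVC.svcOffset m) σ w s lam)
    (hA : L1SVC.StoppingA C (L1SVC.svcMatrix x y) (L1SVC.svcOffset m) σ ε w s lam) :
    (Bornology.IsBounded (Set.range lam) ∧
      ∃ lamStar : EuclideanSpace ℝ (Fin m),
        L1SVC.IsDualOptimal C (L1SVC.svcMatrix x y) (L1SVC.svcOffset m) lamStar ∧
        Tendsto lam atTop (𝓝 lamStar)) ∧
    (Bornology.IsBounded (Set.range fun k => (w k, s k)) ∧
      ∃ qStar : EuclideanSpace ℝ (Fin n) × EuclideanSpace ℝ (Fin m),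
        L1SVC.IsPrimalOptimal C (L1SVC.svcMatrix x y) (L1SVC.svcOffset m) qStar ∧
        (∀ q, L1SVC.IsPrimalOptimal C (L1SVC.svcMatrix x y) (L1SVC.svcOffset m) q → q = qStar) ∧
        Tendsto (fun k => (w k, s k)) atTop (𝓝 qStar)) := by
  obtain ⟨z, hz, hlam, hq⟩ := L1SVC.exists_tendsto_alm hC hALM hA
  exact ⟨⟨Metric.isBounded_range_of_tendsto _ hlam, z, hz.isDualOptimal, hlam⟩,
    Metric.isBounded_range_of_tendsto _ hq, _, hz.isPrimalOptimal hC.le,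
    fun _ h => hz.eq_primalOf hC.le h, hq⟩
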